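/- Setting. Let $M$ be a complex manifold of dimension 2 with holomorphic tangent bundle $T'M$, and let $F:T'M\to[0,\infty)$ be a complex Finsler metric: $F$ is continuous; $L:=F^2$ is smooth outside the zero section; $F(z,\eta)=0$ if and only if $\eta=0$; $F(z,a\eta)=|a|F(z,\eta)$ for $a\in\mathbb C$; and, in the coordinates $(z^k,\eta^k)$ of $T'M$ induced by any complex chart of $M$, the Hermitian matrix $g_{i\bar j}:=\partial^2L/\partial\eta^i\partial\bar\eta^j$ is positive definite for $\eta\ne0$. Let $(g^{\bar m i})$ be the inverse matrix, $g_{j\bar m}g^{\bar m i}=\delta^i_j$. Put (summing over repeated indices) $$N^k_j=g^{\bar m k}\frac{\partial g_{l\bar m}}{\partial z^j}\eta^l,\quad \delta_k=\frac{\partial}{\partial z^k}-N^j_k\frac{\partial}{\partial\eta^j},\quad L^i_{jk}=g^{\bar l i}\delta_kg_{j\bar l},\quad C^i_{jk}=g^{\bar l i}\frac{\partial g_{j\bar l}}{\partial\eta^k},$$ $$R^i_{j\bar hk}=-\delta_{\bar h}L^i_{jk}-\delta_{\bar h}(N^l_k)\,C^i_{jl},\qquad R_{\bar rj\bar hk}=g_{i\bar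 r}R^i_{j\bar hk},$$ where $\delta_{\bar h}$ is the conjugate of $\delta_h$. Put also $l^i=\eta^i/F$, $l_i=g_{i\bar j}\overline{l^j}$, $g=\det(g_{i\bar j})$, $m^1=-l_2/\sqrt g$, $m^2=l_1/\sqrt g$, $\lambda=l^i\delta_i$, $\mu=m^i\delta_i$, and $$J=l^jl^kl_iL^i_{jk},\qquad \mathbf K=-\frac1F\,\bar\eta^k\delta_{\bar k}J.$$ The horizontal holomorphic sectional curvature in direction $\lambda$ is $K^h_{F,\lambda}=2R_{\bar rj\bar hk}\,\overline{l^r}\,l^j\,\overline{l^h}\,l^k$, and in direction $\mu$ it is $K^h_{F,\mu}=2R_{\bar rj\bar hk}\,\overline{m^r}\,m^j\,\overline{m^h}\,m^k$. The space $(M,F)$ is purely Hermitian if in every chart $g_{i\bar j}=g_{i\bar j}(z)$ does not depend on $\eta$, and Kähler if $(L^i_{jk}-L^i_{kj})\eta^j=0$. Theorem 4.13. Let $(M,F)$ be a 2-dimensional Kähler purely Hermitian space for which $\mathbf K$ is constant on $M$, that is, $\mathbf K$ takes the same value at all $(z,\eta)$ with $\eta\ne0$. Then, in every complex chart and at every $(z,\eta)$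 with $\eta\neq0$, $$R_{\bar rj\bar hk}=\frac{\mathbf K}{2}\left(g_{j\bar r}g_{k\bar h}+g_{k\bar r}g_{j\bar h}\right)\quad\text{for all } r,j,h,k\in\{1,2\},$$ and $K^h_{F,\lambda}=K^h_{F,\mu}=2\mathbf K$. -/

import Mathlib

open scoped Manifold ContDiff ComplexConjugate ComplexOrder

noncomputable section

/-! ### Wirtinger derivatives -/

/-- `(1/2) (D_v f - i D_{iv} f)`: the `(1,0)`-derivative of `f` in the direction `v`,
`D` being the real Fréchet derivative. -/
def wirtinger {E : Type*} [NormedAddCommGroup E] [NormedSpace ℂ E]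
    (f : E → ℂ) (v p : E) : ℂ :=
  (1 / 2) * (fderiv ℝ f p v - Complex.I * fderiv ℝ f p (Complex.I • v))

/-- `(1/2) (D_v f + i D_{iv} f)`: the `(0,1)`-derivative of `f` in the direction `v`. -/
def wirtingerBar {E : Type*} [NormedAddCommGroup E] [NormedSpace ℂ E]
    (f : E → ℂ) (v p : E) : ℂ :=
  (1 / 2) * (fderiv ℝ f p v + Complex.I * fderiv ℝ f p (Complex.I • v))

/-! ### Complex Finsler geometry in the coordinates `(z, η)` of the holomorphic tangent bundle

In this section `F` is the fundamental function written in the coordinates `(z, η)` induced on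
`T'M` by a complex chart of `M`. -/

namespace FinslerCoord

variable {n : ℕ}

/-- `∂f/∂z^k`. -/
def dz (k : Fin n) (f : (Fin n → ℂ) × (Fin n → ℂ) → ℂ)
    (p : (Fin n → ℂ) × (Fin n → ℂ)) : ℂ :=
  wirtinger f (Pi.single k 1, 0) p

/-- `∂f/∂z̄^k`. -/
def dzBar (k : Fin n) (f : (Fin n → ℂ) × (Fin n → ℂ) → ℂ)
    (p : (Fin n → ℂ) × (Fin n → ℂ)) : ℂ :=
  wirtingerBar f (Pi.single k 1, 0) p

/-- `∂f/∂η^k`. -/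
def dη (k : Fin n) (f : (Fin n → ℂ) × (Fin n → ℂ) → ℂ)
    (p : (Fin n → ℂ) × (Fin n → ℂ)) : ℂ :=
  wirtinger f (0, Pi.single k 1) p

/-- `∂f/∂η̄^k`. -/
def dηBar (k : Fin n) (f : (Fin n → ℂ) × (Fin n → ℂ) → ℂ)
    (p : (Fin n → ℂ) × (Fin n → ℂ)) : ℂ :=
  wirtingerBar f (0, Pi.single k 1) p

variable (F : (Fin n → ℂ) × (Fin n → ℂ) → ℝ)

/-- The fundamental metric tensor `g_{i j̄} = ∂²L / ∂η^i ∂η̄^j`, where `L = F²`. -/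
def metric (i j : Fin n) (p : (Fin n → ℂ) × (Fin n → ℂ)) : ℂ :=
  dη i (dηBar j (fun q => ((F q ^ 2 : ℝ) : ℂ))) p

/-- The matrix `(g_{i j̄})`, with row index `i` and column index `j`. -/
def metricMatrix (p : (Fin n → ℂ) × (Fin n → ℂ)) : Matrix (Fin n) (Fin n) ℂ :=
  Matrix.of fun i j => metric F i j p

/-- The inverse metric `g^{m̄ i}`, normalised by `∑ m, g_{j m̄} g^{m̄ i} = δ_j^i`. -/
def metricInv (m i : Fin n) (p : (Fin n → ℂ) × (Fin n → ℂ)) : ℂ :=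
  (metricMatrix F p)⁻¹ m i

/-- The Chern-Finsler nonlinear connection `N^k_j = g^{m̄ k} (∂g_{l m̄}/∂z^j) η^l`. -/
def nonlin (k j : Fin n) (p : (Fin n → ℂ) × (Fin n → ℂ)) : ℂ :=
  ∑ m, ∑ l, metricInv F m k p * dz j (metric F l m) p * p.2 l

/-- The horizontal derivative `δ_k f = ∂f/∂z^k - N^j_k ∂f/∂η^j`. -/
def hder (k : Fin n) (f : (Fin n → ℂ) × (Fin n → ℂ) → ℂ)
    (p : (Fin n → ℂ) × (Fin n → ℂ)) : ℂ :=
  dz k f p - ∑ j, nonlin F j k p * dη j f p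

/-- The conjugate horizontal derivative `δ_{k̄} f`. -/
def hderBar (k : Fin n) (f : (Fin n → ℂ) × (Fin n → ℂ) → ℂ)
    (p : (Fin n → ℂ) × (Fin n → ℂ)) : ℂ :=
  dzBar k f p - ∑ j, conj (nonlin F j k p) * dηBar j f p

/-- The horizontal coefficients `L^i_{jk} = g^{l̄ i} δ_k g_{j l̄}` of the Chern-Finsler
connection. -/
def hcoef (i j k : Fin n) (p : (Fin n → ℂ) × (Fin n → ℂ)) : ℂ :=
  ∑ l, metricInv F l i p * hder F k (metric F j l) p

/-- The vertical coefficients `C^i_{jk} = g^{l̄ i} ∂g_{j l̄}/∂η^k` of the Chern-Finsler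
connection. -/
def vcoef (i j k : Fin n) (p : (Fin n → ℂ) × (Fin n → ℂ)) : ℂ :=
  ∑ l, metricInv F l i p * dη k (metric F j l) p

/-- The horizontal torsion `T^i_{jk} = L^i_{jk} - L^i_{kj}`. -/
def torsion (i j k : Fin n) (p : (Fin n → ℂ) × (Fin n → ℂ)) : ℂ :=
  hcoef F i j k p - hcoef F i k j p

/-- The curvature coefficients `R^i_{j h̄ k} = -δ_{h̄} L^i_{jk} - δ_{h̄}(N^l_k) C^i_{jl}`, so that
`R(δ_k, δ_{h̄}) δ_j = R^i_{j h̄ k} δ_i`. -/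
def curvCoef (i j h k : Fin n) (p : (Fin n → ℂ) × (Fin n → ℂ)) : ℂ :=
  -hderBar F h (hcoef F i j k) p - ∑ l, hderBar F h (nonlin F l k) p * vcoef F i j l p

/-- The horizontal Riemann type tensor `R_{r̄ j h̄ k} = g_{i r̄} R^i_{j h̄ k}`. -/
def riemann (r j h k : Fin n) (p : (Fin n → ℂ) × (Fin n → ℂ)) : ℂ :=
  ∑ i, metric F i r p * curvCoef F i j h k p

/-- `𝐑(W, Z̄, X, Ȳ) = 𝒢(R(X, Ȳ) W, Z̄)` for horizontal vectors `W = W^j δ_j`, etc. -/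
def riemannForm (p : (Fin n → ℂ) × (Fin n → ℂ)) (W Z X Y : Fin n → ℂ) : ℂ :=
  ∑ r, ∑ j, ∑ h, ∑ k, riemann F r j h k p * W j * conj (Z r) * X k * conj (Y h)

/-- `l^i = η^i / F`; these are the components of `λ = l^i δ_i`. -/
def lUp (p : (Fin n → ℂ) × (Fin n → ℂ)) (i : Fin n) : ℂ :=
  p.2 i / (F p : ℂ)

/-- `l_i = g_{i j̄} l^{j̄}`. -/
def lDown (p : (Fin n → ℂ) × (Fin n → ℂ)) (i : Fin n) : ℂ :=
  ∑ j, metric F i j p * conj (lUp F p j)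

/-- `J = l^j l^k l_i L^i_{jk}`. -/
def coefJ (p : (Fin n → ℂ) × (Fin n → ℂ)) : ℂ :=
  ∑ i, ∑ j, ∑ k, lUp F p j * lUp F p k * lDown F p i * hcoef F i j k p

/-- The horizontal curvature invariant `𝐊 = -(1/F) J_{|0̄}`, where `J_{|0̄} = η̄^k δ_{k̄} J`. -/
def invK (p : (Fin n → ℂ) × (Fin n → ℂ)) : ℂ :=
  -(1 / (F p : ℂ)) * ∑ k, conj (p.2 k) * hderBar F k (coefJ F) p

/-- The components `(m^1, m^2) = (-l_2, l_1) / √g`, `g = det (g_{i j̄})`, of the second vector `m`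
of the local complex Berwald frame; these are also the components of `μ = m^i δ_i`. -/
def mUp (F : (Fin 2 → ℂ) × (Fin 2 → ℂ) → ℝ) (p : (Fin 2 → ℂ) × (Fin 2 → ℂ)) : Fin 2 → ℂ :=
  ![-lDown F p 1 / ((√((metricMatrix F p).det.re) : ℝ) : ℂ),
    lDown F p 0 / ((√((metricMatrix F p).det.re) : ℝ) : ℂ)]

/-- The horizontal holomorphic sectional curvature in direction `λ`. -/
def sectCurvLambda (p : (Fin n → ℂ) × (Fin n → ℂ)) : ℂ :=
  2 * riemannForm F p (lUp F p) (lUp F p) (lUp F p) (lUp F p)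

/-- The horizontal holomorphic sectional curvature in direction `μ`. -/
def sectCurvMu (F : (Fin 2 → ℂ) × (Fin 2 → ℂ) → ℝ) (p : (Fin 2 → ℂ) × (Fin 2 → ℂ)) : ℂ :=
  2 * riemannForm F p (mUp F p) (mUp F p) (mUp F p) (mUp F p)

end FinslerCoord

/-! ### Complex Finsler spaces

The holomorphic tangent bundle `T'M` of a complex manifold `M` of dimension `n` is the tangent
bundle of `M` over `ℂ`, and the complex charts of `M` are the members of its maximal atlas. -/

section Manifold

variable {n : ℕ} {M : Type*} [TopologicalSpace M] [ChartedSpace (Fin n → ℂ) M]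

/-- The function `F` on `T'M` in the coordinates induced by the chart `φ`: the coordinates
`(z, η)` stand for the vector `η^k ∂/∂z^k = d(φ⁻¹)_z η` at the point `φ⁻¹ z`. -/
def inCoord (F : TangentBundle 𝓘(ℂ, Fin n → ℂ) M → ℝ)
    (φ : OpenPartialHomeomorph M (Fin n → ℂ)) (p : (Fin n → ℂ) × (Fin n → ℂ)) : ℝ :=
  F ⟨φ.symm p.1, mfderiv 𝓘(ℂ, Fin n → ℂ) 𝓘(ℂ, Fin n → ℂ) φ.symm p.1 p.2⟩

/-- `(M, F)` is a complex Finsler space. -/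
structure IsComplexFinsler [IsManifold 𝓘(ℂ, Fin n → ℂ) ω M]
    (F : TangentBundle 𝓘(ℂ, Fin n → ℂ) M → ℝ) : Prop where
  continuous : Continuous F
  /-- `L = F²` is smooth (in the real sense) outside the zero section. -/
  smooth : ∀ φ ∈ IsManifold.maximalAtlas 𝓘(ℂ, Fin n → ℂ) ω M,
    ContDiffOn ℝ ∞ (fun p => inCoord F φ p ^ 2) (φ.target ×ˢ {0}ᶜ)
  nonneg : ∀ v, 0 ≤ F v
  eq_zero_iff : ∀ (x : M) (v : TangentSpace 𝓘(ℂ, Fin n → ℂ) x), F ⟨x, v⟩ = 0 ↔ v = 0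
  homogeneous : ∀ (x : M) (v : TangentSpace 𝓘(ℂ, Fin n → ℂ) x) (a : ℂ),
    F ⟨x, a • v⟩ = ‖a‖ * F ⟨x, v⟩
  posDef : ∀ φ ∈ IsManifold.maximalAtlas 𝓘(ℂ, Fin n → ℂ) ω M,
    ∀ z ∈ φ.target, ∀ η : Fin n → ℂ, η ≠ 0 →
      (FinslerCoord.metricMatrix (inCoord F φ) (z, η)).PosDef

/-- `F` is purely Hermitian: in every chart `g_{i j̄} = g_{i j̄}(z)` does not depend on `η`. -/
def IsPurelyHermitian (F : TangentBundle 𝓘(ℂ, Fin n → ℂ) M → ℝ) : Prop :=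
  ∀ φ ∈ IsManifold.maximalAtlas 𝓘(ℂ, Fin n → ℂ) ω M, ∀ z ∈ φ.target,
    ∀ η η' : Fin n → ℂ, η ≠ 0 → η' ≠ 0 → ∀ i j,
      FinslerCoord.metric (inCoord F φ) i j (z, η) = FinslerCoord.metric (inCoord F φ) i j (z, η')

/-- `F` is Kähler: `T^i_{jk} η^j = 0` in every chart. -/
def IsKahlerFinsler (F : TangentBundle 𝓘(ℂ, Fin n → ℂ) M → ℝ) : Prop :=
  ∀ φ ∈ IsManifold.maximalAtlas 𝓘(ℂ, Fin n → ℂ) ω M, ∀ z ∈ φ.target,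
    ∀ η : Fin n → ℂ, η ≠ 0 → ∀ i k,
      ∑ j, FinslerCoord.torsion (inCoord F φ) i j k (z, η) * η j = 0

/-- The invariant `𝐊` is equal to the constant `c` on the whole space. -/
def HasConstantK (F : TangentBundle 𝓘(ℂ, Fin n → ℂ) M → ℝ) (c : ℂ) : Prop :=
  ∀ φ ∈ IsManifold.maximalAtlas 𝓘(ℂ, Fin n → ℂ) ω M, ∀ z ∈ φ.target,
    ∀ η : Fin n → ℂ, η ≠ 0 → FinslerCoord.invK (inCoord F φ) (z, η) = c

end Manifold

end

/-! For a metric $g(z)$ independent of $\eta$ all connection coefficients are those of the Chern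
connection of a Hermitian metric on $M$: the vertical coefficients $C$ vanish, and $L^i_{jk}$ and
$R_{\bar rj\bar hk}$ depend on $z$ only. By homogeneity $F^2=g_{i\bar j}\eta^i\bar\eta^j$.

The link with $\mathbf K$ is `invK_mul`: $\mathbf K F^4=R_{\bar rj\bar
hk}\bar\eta^r\eta^j\bar\eta^h\eta^k$. It holds because $\delta_{\bar h}F=0$ (`hderBar_coe`) and
$JF^3=\partial_kg_{j\bar l}\,\eta^j\eta^k\bar\eta^l$. Applying $\delta_{\bar h}$ to this polynomial
gives $-R$ contracted with $\eta^j\eta^k\bar\eta^r$ (`hderBar_coefJ`).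

If $\mathbf K$ is constant, the diagonal of $R$ on each fibre is $\mathbf K(g_{i\bar
j}\eta^i\bar\eta^j)^2$, which is also the diagonal of $\frac{\mathbf K}{2}(g_{j\bar r}g_{k\bar
h}+g_{k\bar r}g_{j\bar h})$. The Kähler condition makes $R$ symmetric in $j,k$ and in $r,h$, and a
tensor with these symmetries is determined by its diagonal (`eq_zero_of_quarticForm_diag`), so the
two tensors agree. The sectional curvatures follow since $\lambda$ and $\mu$ are unit vectors.
Dimension 2 enters only through $\mu$. -/

noncomputable section

open Filter Topology

/-! ### Wirtinger calculus -/

section Wirtinger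

variable {E : Type*} [NormedAddCommGroup E] [NormedSpace ℂ E] {f g : E → ℂ} {p : E}

theorem wirtinger_congr (h : f =ᶠ[𝓝 p] g) (v : E) : wirtinger f v p = wirtinger g v p := by
  simp only [wirtinger, h.fderiv_eq]

theorem wirtingerBar_congr (h : f =ᶠ[𝓝 p] g) (v : E) :
    wirtingerBar f v p = wirtingerBar g v p := by
  simp only [wirtingerBar, h.fderiv_eq]

/-- Conjugation exchanges the two operators, so facts about one transfer to the other. -/
theorem wirtingerBar_eq_conj (f : E → ℂ) (v p : E) :
    wirtingerBar f v p = conj (wirtinger (fun q => conj (f q)) v p) := by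
  have h : fderiv ℝ (fun q => conj (f q)) p
      = (Complex.conjCLE : ℂ →L[ℝ] ℂ).comp (fderiv ℝ f p) :=
    Complex.conjCLE.comp_fderiv
  simp only [wirtinger, wirtingerBar, h, ContinuousLinearMap.comp_apply,
    ContinuousLinearEquiv.coe_coe, Complex.conjCLE_apply, map_mul, map_sub, Complex.conj_I,
    Complex.conj_conj, map_div₀, map_one, Complex.conj_ofNat]
  ring

theorem wirtinger_mul (hf : DifferentiableAt ℝ f p) (hg : DifferentiableAt ℝ g p) (v : E) :
    wirtinger (fun q => f q * g q) v p = wirtinger f v p * g p + f p * wirtinger g v p := by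
  simp only [wirtinger, fderiv_fun_mul hf hg, add_apply, smul_apply,
    smul_eq_mul]
  ring

theorem wirtingerBar_mul (hf : DifferentiableAt ℝ f p) (hg : DifferentiableAt ℝ g p) (v : E) :
    wirtingerBar (fun q => f q * g q) v p
      = wirtingerBar f v p * g p + f p * wirtingerBar g v p := by
  simp only [wirtingerBar, fderiv_fun_mul hf hg, add_apply,
    smul_apply, smul_eq_mul]
  ring

theorem wirtinger_sum {ι : Type*} {s : Finset ι} {f : ι → E → ℂ}
    (hf : ∀ i ∈ s, DifferentiableAt ℝ (f i) p) (v : E) :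
    wirtinger (fun q => ∑ i ∈ s, f i q) v p = ∑ i ∈ s, wirtinger (f i) v p := by
  simp only [wirtinger, fderiv_fun_sum hf, sum_apply, Finset.mul_sum,
    ← Finset.sum_sub_distrib]

theorem wirtingerBar_sum {ι : Type*} {s : Finset ι} {f : ι → E → ℂ}
    (hf : ∀ i ∈ s, DifferentiableAt ℝ (f i) p) (v : E) :
    wirtingerBar (fun q => ∑ i ∈ s, f i q) v p = ∑ i ∈ s, wirtingerBar (f i) v p := by
  simp only [wirtingerBar, fderiv_fun_sum hf, sum_apply, Finset.mul_sum,
    ← Finset.sum_add_distrib]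

theorem wirtinger_linear (A : E →L[ℂ] ℂ) (v : E) : wirtinger (fun q => A q) v p = A v := by
  have h : fderiv ℝ (fun q => A q) p = A.restrictScalars ℝ :=
    (A.restrictScalars ℝ).hasFDerivAt.fderiv
  simp only [wirtinger, h, ContinuousLinearMap.coe_restrictScalars', map_smul, smul_eq_mul]
  linear_combination (-(1 / 2) * A v) * Complex.I_mul_I

theorem wirtingerBar_linear (A : E →L[ℂ] ℂ) (v : E) : wirtingerBar (fun q => A q) v p = 0 := by
  have h : fderiv ℝ (fun q => A q) p = A.restrictScalars ℝ :=
    (A.restrictScalars ℝ).hasFDerivAt.fderiv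
  simp only [wirtingerBar, h, ContinuousLinearMap.coe_restrictScalars', map_smul, smul_eq_mul]
  linear_combination ((1 / 2) * A v) * Complex.I_mul_I

theorem wirtingerBar_conj_linear (A : E →L[ℂ] ℂ) (v : E) :
    wirtingerBar (fun q => conj (A q)) v p = conj (A v) := by
  rw [wirtingerBar_eq_conj]
  simp only [Complex.conj_conj, wirtinger_linear]

theorem wirtinger_conj_linear (A : E →L[ℂ] ℂ) (v : E) :
    wirtinger (fun q => conj (A q)) v p = 0 := by
  have := wirtingerBar_eq_conj (fun q => A q) v p
  rw [wirtingerBar_linear] at this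
  simpa using this.symm

theorem fderiv_complex_smul (f : E → ℂ) (p v : E) (c : ℂ) :
    fderiv ℝ f p (c • v) = c.re * fderiv ℝ f p v + c.im * fderiv ℝ f p (Complex.I • v) := by
  have h : c • v = c.re • v + c.im • (Complex.I • v) := by
    conv_lhs => rw [← Complex.re_add_im c]
    rw [add_smul, mul_smul, Complex.coe_smul, Complex.coe_smul]
  rw [h, map_add, map_smul, map_smul, Complex.real_smul, Complex.real_smul]

/-- The real derivative is only real linear in the direction; the combination with $-i$ projects
onto its complex linear part. Through this, the radial derivative of $F^2$ splits into coordinate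
derivatives. -/
theorem wirtinger_smul_dir (f : E → ℂ) (p v : E) (c : ℂ) :
    wirtinger f (c • v) p = c * wirtinger f v p := by
  have h : Complex.I • c • v = (Complex.I * c) • v := smul_smul _ _ _
  rw [wirtinger, wirtinger, h, fderiv_complex_smul f p v c,
    fderiv_complex_smul f p v (Complex.I * c)]
  simp only [Complex.mul_re, Complex.mul_im, Complex.I_re, Complex.I_im]
  push_cast
  linear_combination (1 / 2 * fderiv ℝ f p v - 1 / 2 * Complex.I * fderiv ℝ f p (Complex.I • v)) *
    Complex.re_add_im c + (1 / 2 * fderiv ℝ f p (Complex.I • v) * c.im) * Complex.I_sq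

theorem wirtingerBar_smul_dir (f : E → ℂ) (p v : E) (c : ℂ) :
    wirtingerBar f (c • v) p = conj c * wirtingerBar f v p := by
  rw [wirtingerBar_eq_conj, wirtingerBar_eq_conj, wirtinger_smul_dir, map_mul]

theorem wirtinger_sum_dir {ι : Type*} (s : Finset ι) (f : E → ℂ) (p : E) (v : ι → E) :
    wirtinger f (∑ i ∈ s, v i) p = ∑ i ∈ s, wirtinger f (v i) p := by
  simp only [wirtinger, Finset.smul_sum, map_sum, Finset.mul_sum, ← Finset.sum_sub_distrib]

theorem wirtingerBar_sum_dir {ι : Type*} (s : Finset ι) (f : E → ℂ) (p : E) (v : ι → E) :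
    wirtingerBar f (∑ i ∈ s, v i) p = ∑ i ∈ s, wirtingerBar f (v i) p := by
  simp only [wirtingerBar, Finset.smul_sum, map_sum, Finset.mul_sum, ← Finset.sum_add_distrib]

/-- Both Wirtinger derivatives are invariant under translations. -/
theorem wirtinger_comp_add_right (f : E → ℂ) (v p c : E) :
    wirtinger (fun q => f (q + c)) v p = wirtinger f v (p + c) := by
  simp only [wirtinger, fderiv_comp_add_right]

theorem wirtingerBar_comp_add_right (f : E → ℂ) (v p c : E) :
    wirtingerBar (fun q => f (q + c)) v p = wirtingerBar f v (p + c) := by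
  simp only [wirtingerBar, fderiv_comp_add_right]

theorem ContDiffOn.wirtinger {s : Set E} (hs : IsOpen s) (hf : ContDiffOn ℝ ∞ f s) (v : E) :
    ContDiffOn ℝ ∞ (_root_.wirtinger f v) s := by
  have h : ContDiffOn ℝ ∞ (fderiv ℝ f) s := hf.fderiv_of_isOpen hs (by simp)
  exact contDiffOn_const.mul ((h.clm_apply contDiffOn_const).sub
    (contDiffOn_const.mul (h.clm_apply contDiffOn_const)))

theorem ContDiffOn.wirtingerBar {s : Set E} (hs : IsOpen s) (hf : ContDiffOn ℝ ∞ f s) (v : E) :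
    ContDiffOn ℝ ∞ (_root_.wirtingerBar f v) s := by
  have h : ContDiffOn ℝ ∞ (fderiv ℝ f) s := hf.fderiv_of_isOpen hs (by simp)
  exact contDiffOn_const.mul ((h.clm_apply contDiffOn_const).add
    (contDiffOn_const.mul (h.clm_apply contDiffOn_const)))

/-- Both sides are the same combination of second real derivatives, up to the symmetry of the
Hessian. -/
theorem wirtingerBar_wirtinger_comm (hf : ContDiffAt ℝ ∞ f p) (v w : E) :
    wirtingerBar (wirtinger f v) w p = wirtinger (wirtingerBar f w) v p := by
  have hd : DifferentiableAt ℝ (fderiv ℝ f) p :=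
    (hf.fderiv_right (m := 1) (by norm_cast)).differentiableAt (by simp)
  have hs : IsSymmSndFDerivAt ℝ f p :=
    hf.isSymmSndFDerivAt (by simp only [minSmoothness_of_isRCLikeNormedField]; norm_cast)
  have ha (u : E) : DifferentiableAt ℝ (fun q => fderiv ℝ f q u) p :=
    hd.clm_apply (differentiableAt_const u)
  have h2 (u x : E) : fderiv ℝ (fun q => fderiv ℝ f q u) p x = fderiv ℝ (fderiv ℝ f) p x u := by
    rw [fderiv_clm_apply hd (differentiableAt_const u)]
    simp
  have h3 (u x : E) : fderiv ℝ (wirtinger f u) p x = 1 / 2 * (fderiv ℝ (fderiv ℝ f) p x u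
      - Complex.I * fderiv ℝ (fderiv ℝ f) p x (Complex.I • u)) := by
    have : wirtinger f u = fun q => 1 / 2 * (fderiv ℝ f q u
      - Complex.I * fderiv ℝ f q (Complex.I • u)) := rfl
    rw [this, fderiv_const_mul ((ha u).fun_sub ((ha _).const_mul _)),
      fderiv_fun_sub (ha u) ((ha _).const_mul _), fderiv_const_mul (ha _)]
    simp [h2]
  have h4 (u x : E) : fderiv ℝ (wirtingerBar f u) p x = 1 / 2 * (fderiv ℝ (fderiv ℝ f) p x u
      + Complex.I * fderiv ℝ (fderiv ℝ f) p x (Complex.I • u)) := by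
    have : wirtingerBar f u = fun q => 1 / 2 * (fderiv ℝ f q u
      + Complex.I * fderiv ℝ f q (Complex.I • u)) := rfl
    rw [this, fderiv_const_mul ((ha u).fun_add ((ha _).const_mul _)),
      fderiv_fun_add (ha u) ((ha _).const_mul _), fderiv_const_mul (ha _)]
    simp [h2, mul_add]
  rw [wirtingerBar, wirtinger]
  simp only [h3, h4]
  rw [hs.eq v w, hs.eq v (Complex.I • w), hs.eq (Complex.I • v) w,
    hs.eq (Complex.I • v) (Complex.I • w)]
  ring

end Wirtinger

/-! ### Polarization of biquadratic forms -/

section Polarization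

variable {n : ℕ}

/-- Three adjacent transpositions give the exchange of the outer indices, as needed for the pairs
$(j,k)$ and $(r,h)$ in the order $r,j,h,k$. -/
theorem Finset.sum_swap_outer {ι A : Type*} [Fintype ι] [AddCommMonoid A] (f : ι → ι → ι → A) :
    ∑ i, ∑ j, ∑ k, f i j k = ∑ i, ∑ j, ∑ k, f k j i :=
  Finset.sum_comm.trans ((Finset.sum_congr rfl fun _ _ => Finset.sum_comm).trans Finset.sum_comm)

/-- The form `∑ S_{r j h k} a^j b^k c̄^r d̄^h`. -/
def quarticForm (S : Fin n → Fin n → Fin n → Fin n → ℂ) (a b c d : Fin n → ℂ) : ℂ :=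
  ∑ r, ∑ j, ∑ h, ∑ k, S r j h k * a j * b k * conj (c r) * conj (d h)

variable (S : Fin n → Fin n → Fin n → Fin n → ℂ)

theorem quarticForm_add_smul (a b c d a' b' c' d' : Fin n → ℂ) (t : ℂ) :
    quarticForm S (a + t • a') b c d = quarticForm S a b c d + t * quarticForm S a' b c d ∧
    quarticForm S a (b + t • b') c d = quarticForm S a b c d + t * quarticForm S a b' c d ∧
    quarticForm S a b (c + t • c') d = quarticForm S a b c d + conj t * quarticForm S a b c' d ∧
    quarticForm S a b c (d + t • d') = quarticForm S a b c d + conj t * quarticForm S a b c d' := by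
  simp only [quarticForm, Finset.mul_sum, ← Finset.sum_add_distrib, Pi.add_apply, Pi.smul_apply,
    smul_eq_mul, map_add, map_mul]
  refine ⟨?_, ?_, ?_, ?_⟩ <;>
  · refine Finset.sum_congr rfl fun _ _ => Finset.sum_congr rfl fun _ _ =>
      Finset.sum_congr rfl fun _ _ => Finset.sum_congr rfl fun _ _ => ?_
    ring

/-- A sesquilinear form on a complex space that vanishes on the diagonal is zero. -/
theorem sesquilinear_eq_zero_of_diag {V : Type*} [AddCommGroup V] [Module ℂ V] (H : V → V → ℂ)
    (hl : ∀ x x' y (t : ℂ), H (x + t • x') y = H x y + t * H x' y)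
    (hr : ∀ x y y' (t : ℂ), H x (y + t • y') = H x y + conj t * H x y')
    (h0 : ∀ x, H x x = 0) (x y : V) : H x y = 0 := by
  -- The diagonal at $x+y$ and at $x+iy$ gives $H(x,y)+H(y,x)=0$ and $H(x,y)-H(y,x)=0$.
  have h1 := h0 (x + (1 : ℂ) • y)
  have h2 := h0 (x + Complex.I • y)
  simp only [hl, hr, h0, map_one, Complex.conj_I] at h1 h2
  linear_combination (1 / 2) * h1 + (Complex.I / 2) * h2
    + (1 / 2 * H x y - 1 / 2 * H y x) * Complex.I_sq

variable {S}

/-- A biquadratic form that vanishes on the diagonal is zero. -/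
theorem eq_zero_of_quarticForm_diag (hjk : ∀ r j h k, S r j h k = S r k h j)
    (hrh : ∀ r j h k, S r j h k = S h j r k)
    (h0 : ∀ x, quarticForm S x x x x = 0) (r j h k : Fin n) : S r j h k = 0 := by
  have e1 (a b c d a' : Fin n → ℂ) (t : ℂ) := (quarticForm_add_smul S a b c d a' b c d t).1
  have e2 (a b c d b' : Fin n → ℂ) (t : ℂ) := (quarticForm_add_smul S a b c d a b' c d t).2.1
  have e3 (a b c d c' : Fin n → ℂ) (t : ℂ) := (quarticForm_add_smul S a b c d a b c' d t).2.2.1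
  have e4 (a b c d d' : Fin n → ℂ) (t : ℂ) := (quarticForm_add_smul S a b c d a b c d' t).2.2.2
  have s1 (a b c d : Fin n → ℂ) : quarticForm S a b c d = quarticForm S b a c d := by
    unfold quarticForm
    refine Finset.sum_congr rfl fun r _ => (Finset.sum_swap_outer _).trans ?_
    refine Finset.sum_congr rfl fun j _ => Finset.sum_congr rfl fun h _ =>
      Finset.sum_congr rfl fun k _ => ?_
    rw [hjk]; ring
  have s2 (a b c d : Fin n → ℂ) : quarticForm S a b c d = quarticForm S a b d c := by
    unfold quarticForm
    refine (Finset.sum_swap_outer _).trans ?_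
    refine Finset.sum_congr rfl fun r _ => Finset.sum_congr rfl fun j _ =>
      Finset.sum_congr rfl fun h _ => Finset.sum_congr rfl fun k _ => ?_
    rw [hrh]; ring
  -- Summing the diagonal at $x+ty$ over the fourth roots of unity $t$ keeps only the terms with
  -- equally many $t$ and $\bar t$. Besides the pure terms these are four mixed terms, all equal to
  -- the one sought by the symmetries of $S$.
  have m (x y : Fin n → ℂ) : quarticForm S x y x y = 0 := by
    have t1 := h0 (x + (1 : ℂ) • y)
    have t2 := h0 (x + (-1 : ℂ) • y)
    have t3 := h0 (x + Complex.I • y)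
    have t4 := h0 (x + (-Complex.I) • y)
    simp only [e1, e2, e3, e4, h0, map_one, map_neg, Complex.conj_I] at t1 t2 t3 t4
    have u1 := s2 x y x y
    have u2 := s1 x y x y
    have u3 := (s2 y x y x).trans u2.symm
    linear_combination (t1 + t2 + t3 + t4) / 16 + (u1 - u3 + u2) / 4
      - (1 / 8) * (quarticForm S y y x x + quarticForm S x x y y - quarticForm S x y x y
        - quarticForm S y x x y - quarticForm S x y y x - quarticForm S y x y x) * Complex.I_sq
  -- Sesquilinear polarization, once in slots 1 and 3 and then once in slots 2 and 4, frees all four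
  -- arguments.
  have m1 (x x' y : Fin n → ℂ) : quarticForm S x y x' y = 0 :=
    sesquilinear_eq_zero_of_diag (fun x x' => quarticForm S x y x' y)
      (fun _ _ _ _ => e1 _ _ _ _ _ _) (fun _ _ _ _ => e3 _ _ _ _ _ _) (fun x => m x y) x x'
  have m2 (x x' y y' : Fin n → ℂ) : quarticForm S x y x' y' = 0 :=
    sesquilinear_eq_zero_of_diag (fun y y' => quarticForm S x y x' y')
      (fun _ _ _ _ => e2 _ _ _ _ _ _) (fun _ _ _ _ => e4 _ _ _ _ _ _) (fun y => m1 x x' y) y y'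
  have := m2 (Pi.single j 1) (Pi.single r 1) (Pi.single k 1) (Pi.single h 1)
  simpa [quarticForm, Pi.single_apply] using this

end Polarization

/-! ### Purely Hermitian metrics in coordinates -/

namespace FinslerCoord

variable {n : ℕ}

/-- `f(z, η)` does not depend on `η ≠ 0` for `z ∈ U`. -/
def FiberConst (U : Set (Fin n → ℂ)) (f : (Fin n → ℂ) × (Fin n → ℂ) → ℂ) : Prop :=
  ∀ z ∈ U, ∀ η η' : Fin n → ℂ, η ≠ 0 → η' ≠ 0 → f (z, η) = f (z, η')

/-! ### Functions constant along the punctured fibres -/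

section FiberConst

variable {U : Set (Fin n → ℂ)} {f : (Fin n → ℂ) × (Fin n → ℂ) → ℂ}
  {p : (Fin n → ℂ) × (Fin n → ℂ)}

theorem mem_nhds_slit (hU : IsOpen U) (hp : p ∈ U ×ˢ ({0}ᶜ : Set (Fin n → ℂ))) :
    U ×ˢ ({0}ᶜ : Set (Fin n → ℂ)) ∈ 𝓝 p :=
  (hU.prod isOpen_compl_singleton).mem_nhds hp

/-- Translation invariance of the derivative then gives fibre constancy of all Wirtinger
derivatives, with no differentiability assumed. -/
theorem FiberConst.eventuallyEq_translate (hf : FiberConst U f) (hU : IsOpen U) {z η η' : Fin n → ℂ}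
    (hz : z ∈ U) (hη : η ≠ 0) (hη' : η' ≠ 0) :
    f =ᶠ[𝓝 (z, η)] fun q => f (q + (0, η' - η)) := by
  have h1 : ∀ᶠ q in 𝓝 (z, η), q ∈ U ×ˢ ({0}ᶜ : Set (Fin n → ℂ)) :=
    mem_nhds_slit hU ⟨hz, hη⟩
  have hc : Continuous fun q : (Fin n → ℂ) × (Fin n → ℂ) => q + (0, η' - η) := by fun_prop
  have h2 : ∀ᶠ q in 𝓝 (z, η), q + (0, η' - η) ∈ U ×ˢ ({0}ᶜ : Set (Fin n → ℂ)) :=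
    hc.continuousAt.eventually (mem_nhds_slit hU ⟨by simpa using hz, by simpa using hη'⟩)
  filter_upwards [h1, h2] with q hq hq'
  have h3 : q + (0, η' - η) = (q.1, q.2 + (η' - η)) := by ext <;> simp
  rw [h3] at hq' ⊢
  exact hf q.1 hq.1 q.2 _ hq.2 hq'.2

theorem FiberConst.wirtinger (hf : FiberConst U f) (hU : IsOpen U)
    (v : (Fin n → ℂ) × (Fin n → ℂ)) : FiberConst U (wirtinger f v) := by
  intro z hz η η' hη hη'
  rw [wirtinger_congr (hf.eventuallyEq_translate hU hz hη hη'), wirtinger_comp_add_right]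
  simp

theorem FiberConst.wirtingerBar (hf : FiberConst U f) (hU : IsOpen U)
    (v : (Fin n → ℂ) × (Fin n → ℂ)) : FiberConst U (wirtingerBar f v) := by
  intro z hz η η' hη hη'
  rw [wirtingerBar_congr (hf.eventuallyEq_translate hU hz hη hη'), wirtingerBar_comp_add_right]
  simp

theorem FiberConst.fderiv_vertical (hf : FiberConst U f)
    (hp : p ∈ U ×ˢ ({0}ᶜ : Set (Fin n → ℂ))) (w : Fin n → ℂ) :
    fderiv ℝ f p (0, w) = 0 := by
  by_cases hd : DifferentiableAt ℝ f p
  · rw [← hd.lineDeriv_eq_fderiv, lineDeriv]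
    have hc : Continuous fun t : ℝ => p.2 + t • w := by fun_prop
    have h : (fun t : ℝ => f (p + t • ((0, w) : (Fin n → ℂ) × (Fin n → ℂ)))) =ᶠ[𝓝 0]
        fun _ => f p := by
      have h0 : ∀ᶠ t : ℝ in 𝓝 0, p.2 + t • w ∈ ({0}ᶜ : Set (Fin n → ℂ)) :=
        hc.continuousAt.eventually
          (isOpen_compl_singleton.mem_nhds (by simpa using hp.2))
      filter_upwards [h0] with t ht
      have : p + t • ((0, w) : (Fin n → ℂ) × (Fin n → ℂ)) = (p.1, p.2 + t • w) := by
        ext <;> simp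
      rw [this]
      exact hf p.1 hp.1 _ _ ht hp.2
    rw [h.deriv_eq, deriv_const]
  -- Without differentiability `fderiv` takes its default value 0.
  · simp [fderiv_zero_of_not_differentiableAt hd]

theorem FiberConst.dη_eq_zero (hf : FiberConst U f)
    (hp : p ∈ U ×ˢ ({0}ᶜ : Set (Fin n → ℂ))) (k : Fin n) : dη k f p = 0 := by
  simp [dη, _root_.wirtinger, Prod.smul_mk, hf.fderiv_vertical hp]

theorem FiberConst.dηBar_eq_zero (hf : FiberConst U f)
    (hp : p ∈ U ×ˢ ({0}ᶜ : Set (Fin n → ℂ))) (k : Fin n) : dηBar k f p = 0 := by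
  simp [dηBar, _root_.wirtingerBar, Prod.smul_mk, hf.fderiv_vertical hp]

end FiberConst

/-! ### The derivation $\delta_{\bar k}$ on coordinates and products -/

section HorizontalDerivative

variable (F : (Fin n → ℂ) × (Fin n → ℂ) → ℝ) {f g : (Fin n → ℂ) × (Fin n → ℂ) → ℂ}
  {p : (Fin n → ℂ) × (Fin n → ℂ)} (k : Fin n)

theorem hderBar_congr (h : f =ᶠ[𝓝 p] g) : hderBar F k f p = hderBar F k g p := by
  simp only [hderBar, dzBar, dηBar, wirtingerBar_congr h]

theorem hderBar_mul (hf : DifferentiableAt ℝ f p) (hg : DifferentiableAt ℝ g p) :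
    hderBar F k (fun q => f q * g q) p = hderBar F k f p * g p + f p * hderBar F k g p := by
  simp only [hderBar, dzBar, dηBar, wirtingerBar_mul hf hg, mul_add, Finset.sum_add_distrib,
    sub_mul, mul_sub, Finset.sum_mul, Finset.mul_sum]
  have h1 : ∀ x, conj (nonlin F x k p) * (wirtingerBar f (0, Pi.single x 1) p * g p)
      = conj (nonlin F x k p) * wirtingerBar f (0, Pi.single x 1) p * g p := fun _ => by ring
  have h2 : ∀ x, conj (nonlin F x k p) * (f p * wirtingerBar g (0, Pi.single x 1) p)
      = f p * (conj (nonlin F x k p) * wirtingerBar g (0, Pi.single x 1) p) := fun _ => by ring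
  simp only [h1, h2]
  ring

theorem hderBar_sum {ι : Type*} {s : Finset ι} {f : ι → (Fin n → ℂ) × (Fin n → ℂ) → ℂ}
    (hf : ∀ i ∈ s, DifferentiableAt ℝ (f i) p) :
    hderBar F k (fun q => ∑ i ∈ s, f i q) p = ∑ i ∈ s, hderBar F k (f i) p := by
  simp only [hderBar, dzBar, dηBar, wirtingerBar_sum hf, Finset.mul_sum, Finset.sum_sub_distrib]
  rw [Finset.sum_comm]

/-- The projection `(z, η) ↦ η^l`. -/
def fiberCoord (l : Fin n) : ((Fin n → ℂ) × (Fin n → ℂ)) →L[ℂ] ℂ :=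
  (ContinuousLinearMap.proj l).comp (ContinuousLinearMap.snd ℂ (Fin n → ℂ) (Fin n → ℂ))

theorem fiberCoord_apply (l : Fin n) (q : (Fin n → ℂ) × (Fin n → ℂ)) :
    fiberCoord l q = q.2 l := rfl

theorem hderBar_fiberCoord (l : Fin n) : hderBar F k (fun q => q.2 l) p = 0 := by
  simp only [← fiberCoord_apply, hderBar, dzBar, dηBar, wirtingerBar_linear]
  simp

/-- For polynomials in $\eta,\bar\eta$ with fibre-constant coefficients, the nonlinear connection
enters $\delta_{\bar k}$ only through this value. -/
theorem hderBar_conj_fiberCoord (l : Fin n) :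
    hderBar F k (fun q => conj (q.2 l)) p = -conj (nonlin F l k p) := by
  simp only [← fiberCoord_apply, hderBar, dzBar, dηBar, wirtingerBar_conj_linear]
  simp [fiberCoord_apply, Pi.single_apply]

theorem FiberConst.hderBar_eq {U : Set (Fin n → ℂ)} (hf : FiberConst U f)
    (hp : p ∈ U ×ˢ ({0}ᶜ : Set (Fin n → ℂ))) : hderBar F k f p = dzBar k f p := by
  simp [hderBar, hf.dηBar_eq_zero hp]

theorem FiberConst.hder_eq {U : Set (Fin n → ℂ)} (hf : FiberConst U f)
    (hp : p ∈ U ×ˢ ({0}ᶜ : Set (Fin n → ℂ))) : hder F k f p = dz k f p := by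
  simp [hder, hf.dη_eq_zero hp]

theorem differentiable_fiberCoord (l : Fin n) :
    Differentiable ℝ fun q : (Fin n → ℂ) × (Fin n → ℂ) => q.2 l := by fun_prop

theorem differentiable_conj_fiberCoord (l : Fin n) :
    Differentiable ℝ fun q : (Fin n → ℂ) × (Fin n → ℂ) => conj (q.2 l) :=
  Complex.conjCLE.differentiable.comp (differentiable_fiberCoord l)

end HorizontalDerivative

/-- `F` is the coordinate expression over `U` of a purely Hermitian complex Finsler metric. -/
structure IsPurelyHermitianOn (F : (Fin n → ℂ) × (Fin n → ℂ) → ℝ) (U : Set (Fin n → ℂ)) :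
    Prop where
  isOpen : IsOpen U
  smooth : ContDiffOn ℝ ∞ (fun p => F p ^ 2) (U ×ˢ {0}ᶜ)
  nonneg : ∀ p, 0 ≤ F p
  homogeneous : ∀ z ∈ U, ∀ (η : Fin n → ℂ) (a : ℂ), F (z, a • η) = ‖a‖ * F (z, η)
  posDef : ∀ p ∈ U ×ˢ ({0}ᶜ : Set (Fin n → ℂ)), (metricMatrix F p).PosDef
  fiberConst : ∀ i j, FiberConst U (metric F i j)

/-! ### Homogeneity, Euler identities and the inverse metric -/

namespace IsPurelyHermitianOn

variable {F : (Fin n → ℂ) × (Fin n → ℂ) → ℝ} {U : Set (Fin n → ℂ)}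
  {p : (Fin n → ℂ) × (Fin n → ℂ)}

theorem isOpen_slit (hF : IsPurelyHermitianOn F U) : IsOpen (U ×ˢ ({0}ᶜ : Set (Fin n → ℂ))) :=
  hF.isOpen.prod isOpen_compl_singleton

theorem contDiffOn_sq (hF : IsPurelyHermitianOn F U) :
    ContDiffOn ℝ ∞ (fun q => ((F q ^ 2 : ℝ) : ℂ)) (U ×ˢ ({0}ᶜ : Set (Fin n → ℂ))) :=
  Complex.ofRealCLM.contDiff.comp_contDiffOn hF.smooth

theorem contDiffOn_metric (hF : IsPurelyHermitianOn F U) (i j : Fin n) :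
    ContDiffOn ℝ ∞ (metric F i j) (U ×ˢ ({0}ᶜ : Set (Fin n → ℂ))) :=
  (hF.contDiffOn_sq.wirtingerBar hF.isOpen_slit _).wirtinger hF.isOpen_slit _

/-- Homogeneity gives $F^2(z,(1+ta)\eta)=|1+ta|^2F^2(z,\eta)$ for real $t$, differentiated here at
$t=0$. The choices $a=1$ and $a=i$ yield both Euler identities. -/
theorem fderiv_sq_radial (hF : IsPurelyHermitianOn F U)
    (hp : p ∈ U ×ˢ ({0}ᶜ : Set (Fin n → ℂ))) (a : ℂ) :
    fderiv ℝ (fun q => ((F q ^ 2 : ℝ) : ℂ)) p (0, a • p.2) = 2 * a.re * (F p : ℂ) ^ 2 := by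
  have hd : DifferentiableAt ℝ (fun q => ((F q ^ 2 : ℝ) : ℂ)) p :=
    (hF.contDiffOn_sq.contDiffAt (mem_nhds_slit hF.isOpen hp)).differentiableAt (by simp)
  rw [← hd.lineDeriv_eq_fderiv, lineDeriv]
  have h (t : ℝ) : F (p + t • ((0, a • p.2) : (Fin n → ℂ) × (Fin n → ℂ))) ^ 2
      = (1 + 2 * a.re * t + Complex.normSq a * t ^ 2) * F p ^ 2 := by
    have h1 : p + t • ((0, a • p.2) : (Fin n → ℂ) × (Fin n → ℂ)) = (p.1, (1 + t * a) • p.2) := by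
      ext i <;> simp
      ring
    rw [h1, hF.homogeneous p.1 hp.1, mul_pow, ← Complex.normSq_eq_norm_sq]
    simp only [Complex.normSq_apply, Complex.add_re, Complex.add_im, Complex.mul_re,
      Complex.mul_im, Complex.one_re, Complex.one_im, Complex.ofReal_re, Complex.ofReal_im]
    ring
  simp only [h]
  have h2 : HasDerivAt (fun t : ℝ => (1 + 2 * a.re * t + Complex.normSq a * t ^ 2) * F p ^ 2)
      (2 * a.re * F p ^ 2) 0 := by
    have := ((((hasDerivAt_id (0 : ℝ)).const_mul (2 * a.re)).const_add 1).add
      (((hasDerivAt_id (0 : ℝ)).pow 2).const_mul (Complex.normSq a))).mul_const (F p ^ 2)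
    exact this.congr_deriv (by simp)
  rw [h2.ofReal_comp.deriv]
  push_cast
  ring

theorem vertical_eq_sum (w : Fin n → ℂ) :
    ((0, w) : (Fin n → ℂ) × (Fin n → ℂ)) = ∑ j, w j • (0, Pi.single j 1) := by
  ext i
  · simp [Prod.fst_sum]
  · simp [Prod.snd_sum, Finset.sum_apply, Pi.single_apply]

/-- Euler's identity for the antiholomorphic fibre derivatives of `F²`. -/
theorem sum_conj_mul_dηBar (hF : IsPurelyHermitianOn F U)
    (hp : p ∈ U ×ˢ ({0}ᶜ : Set (Fin n → ℂ))) :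
    ∑ j, conj (p.2 j) * dηBar j (fun q => ((F q ^ 2 : ℝ) : ℂ)) p = (F p : ℂ) ^ 2 := by
  simp only [dηBar, ← wirtingerBar_smul_dir]
  rw [← wirtingerBar_sum_dir, ← vertical_eq_sum, wirtingerBar]
  have h1 := hF.fderiv_sq_radial hp 1
  have h2 := hF.fderiv_sq_radial hp Complex.I
  simp only [one_smul, Complex.one_re, Complex.I_re] at h1 h2
  rw [Prod.smul_mk, smul_zero, h1, h2]
  push_cast
  ring

/-- Euler's identity for the holomorphic fibre derivatives of `F²`. -/
theorem sum_mul_dη (hF : IsPurelyHermitianOn F U)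
    (hp : p ∈ U ×ˢ ({0}ᶜ : Set (Fin n → ℂ))) :
    ∑ j, p.2 j * dη j (fun q => ((F q ^ 2 : ℝ) : ℂ)) p = (F p : ℂ) ^ 2 := by
  simp only [dη, ← wirtinger_smul_dir]
  rw [← wirtinger_sum_dir, ← vertical_eq_sum, wirtinger]
  have h1 := hF.fderiv_sq_radial hp 1
  have h2 := hF.fderiv_sq_radial hp Complex.I
  simp only [one_smul, Complex.one_re, Complex.I_re] at h1 h2
  rw [Prod.smul_mk, smul_zero, h1, h2]
  push_cast
  ring

/-- This is the antiholomorphic Euler identity differentiated by $\partial/\partial\eta^i$, which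
annihilates $\bar\eta^j$. -/
theorem dη_sq (hF : IsPurelyHermitianOn F U)
    (hp : p ∈ U ×ˢ ({0}ᶜ : Set (Fin n → ℂ))) (i : Fin n) :
    dη i (fun q => ((F q ^ 2 : ℝ) : ℂ)) p = ∑ j, metric F i j p * conj (p.2 j) := by
  have h : (fun q => ((F q ^ 2 : ℝ) : ℂ)) =ᶠ[𝓝 p]
      fun q => ∑ j, conj (q.2 j) * dηBar j (fun q => ((F q ^ 2 : ℝ) : ℂ)) q := by
    filter_upwards [mem_nhds_slit hF.isOpen hp] with q hq
    rw [hF.sum_conj_mul_dηBar hq]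
    push_cast
    rfl
  have hd (j : Fin n) : DifferentiableAt ℝ (dηBar j fun q => ((F q ^ 2 : ℝ) : ℂ)) p :=
    ((hF.contDiffOn_sq.wirtingerBar hF.isOpen_slit _).contDiffAt
      (mem_nhds_slit hF.isOpen hp)).differentiableAt (by simp)
  have hc (j : Fin n) := differentiable_conj_fiberCoord j p
  rw [dη, wirtinger_congr h, wirtinger_sum fun j _ => (hc j).fun_mul (hd j)]
  refine Finset.sum_congr rfl fun j _ => ?_
  rw [wirtinger_mul (hc j) (hd j)]
  simp only [← fiberCoord_apply, wirtinger_conj_linear, zero_mul, zero_add]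
  rw [mul_comm]
  rfl

/-- `F² = g_{i j̄} η^i η̄^j`. -/
theorem sq_eq_sum (hF : IsPurelyHermitianOn F U) (hp : p ∈ U ×ˢ ({0}ᶜ : Set (Fin n → ℂ))) :
    (F p : ℂ) ^ 2 = ∑ i, ∑ j, metric F i j p * p.2 i * conj (p.2 j) := by
  rw [← hF.sum_mul_dη hp]
  refine Finset.sum_congr rfl fun i _ => ?_
  rw [hF.dη_sq hp, Finset.mul_sum]
  exact Finset.sum_congr rfl fun j _ => by ring

theorem conj_metric (hF : IsPurelyHermitianOn F U) (hp : p ∈ U ×ˢ ({0}ᶜ : Set (Fin n → ℂ)))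
    (i j : Fin n) : conj (metric F i j p) = metric F j i p :=
  (hF.posDef p hp).isHermitian.apply j i

theorem conj_metricInv (hF : IsPurelyHermitianOn F U) (hp : p ∈ U ×ˢ ({0}ᶜ : Set (Fin n → ℂ)))
    (i j : Fin n) : conj (metricInv F i j p) = metricInv F j i p :=
  (hF.posDef p hp).isHermitian.inv.apply j i

theorem isUnit_det (hF : IsPurelyHermitianOn F U) (hp : p ∈ U ×ˢ ({0}ᶜ : Set (Fin n → ℂ))) :
    IsUnit (metricMatrix F p).det :=
  (Matrix.isUnit_iff_isUnit_det _).1 (hF.posDef p hp).isUnit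

theorem sum_metric_mul_metricInv (hF : IsPurelyHermitianOn F U)
    (hp : p ∈ U ×ˢ ({0}ᶜ : Set (Fin n → ℂ))) (i j : Fin n) :
    ∑ m, metric F i m p * metricInv F m j p = if i = j then 1 else 0 := by
  have := congr_fun (congr_fun (Matrix.mul_nonsing_inv _ (hF.isUnit_det hp)) i) j
  rwa [Matrix.mul_apply, Matrix.one_apply] at this

theorem sum_metricInv_mul_metric (hF : IsPurelyHermitianOn F U)
    (hp : p ∈ U ×ˢ ({0}ᶜ : Set (Fin n → ℂ))) (i j : Fin n) :
    ∑ m, metricInv F i m p * metric F m j p = if i = j then 1 else 0 := by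
  have := congr_fun (congr_fun (Matrix.nonsing_inv_mul _ (hF.isUnit_det hp)) i) j
  rwa [Matrix.mul_apply, Matrix.one_apply] at this

theorem pos (hF : IsPurelyHermitianOn F U) (hp : p ∈ U ×ˢ ({0}ᶜ : Set (Fin n → ℂ))) :
    0 < F p := by
  -- The row index of the metric is the holomorphic one, so the quadratic form has to be evaluated
  -- at $\bar\eta$ to give $g_{i\bar j}\eta^i\bar\eta^j$.
  have h := (hF.posDef p hp).dotProduct_mulVec_pos (x := star p.2) (by simpa using hp.2)
  refine (hF.nonneg p).lt_of_ne fun h0 => h.ne' ?_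
  have := hF.sq_eq_sum hp
  rw [← h0] at this
  simp only [Complex.ofReal_zero, ne_eq, OfNat.ofNat_ne_zero, not_false_eq_true, zero_pow] at this
  rw [this]
  simp only [dotProduct, Matrix.mulVec, metricMatrix, Matrix.of_apply, Finset.mul_sum,
    Pi.star_apply, RCLike.star_def, Complex.conj_conj]
  exact Finset.sum_congr rfl fun i _ => Finset.sum_congr rfl fun j _ => by ring

theorem contDiffAt_det {E : Type*} [NormedAddCommGroup E] [NormedSpace ℝ E] {x : E}
    {A : E → Matrix (Fin n) (Fin n) ℂ} (hA : ∀ i j, ContDiffAt ℝ ∞ (fun q => A q i j) x) :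
    ContDiffAt ℝ ∞ (fun q => (A q).det) x := by
  simp only [Matrix.det_apply]
  exact ContDiffAt.sum fun σ _ => (contDiffAt_prod fun i _ => hA _ _).const_smul _

/-- Cramer's rule writes each entry as a quotient of determinants in the smooth entries of $g$. -/
theorem contDiffAt_metricInv (hF : IsPurelyHermitianOn F U)
    (hp : p ∈ U ×ˢ ({0}ᶜ : Set (Fin n → ℂ))) (i j : Fin n) :
    ContDiffAt ℝ ∞ (metricInv F i j) p := by
  have hA (i j : Fin n) : ContDiffAt ℝ ∞ (fun q => metricMatrix F q i j) p :=
    (hF.contDiffOn_metric i j).contDiffAt (mem_nhds_slit hF.isOpen hp)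
  have h : metricInv F i j = fun q => (metricMatrix F q).det⁻¹
      * ((metricMatrix F q).updateRow j (Pi.single i 1)).det := by
    ext q
    simp [metricInv, Matrix.inv_def, Matrix.adjugate_apply]
  rw [h]
  refine ((contDiffAt_det hA).inv (hF.isUnit_det hp).ne_zero).mul (contDiffAt_det fun a b => ?_)
  simp only [Matrix.updateRow_apply]
  split_ifs
  · exact contDiffAt_const
  · exact hA a b

end IsPurelyHermitianOn
end FinslerCoord

namespace FinslerCoord

variable {n : ℕ}

/-- `F` is Kähler over `U`. -/
def IsKahlerOn (F : (Fin n → ℂ) × (Fin n → ℂ) → ℝ) (U : Set (Fin n → ℂ)) : Prop :=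
  ∀ p ∈ U ×ˢ ({0}ᶜ : Set (Fin n → ℂ)), ∀ i k, ∑ j, torsion F i j k p * p.2 j = 0

/-- The diagonal of the curvature tensor of constant holomorphic sectional curvature. -/
theorem quarticForm_metric (g : Fin n → Fin n → ℂ) (K : ℂ) (x : Fin n → ℂ) :
    quarticForm (fun r j h k => K / 2 * (g j r * g k h + g k r * g j h)) x x x x
      = K * ((∑ i, ∑ j, g i j * x i * conj (x j)) * ∑ i, ∑ j, g i j * x i * conj (x j)) := by
  have h0 : ∑ i, ∑ j, g i j * x i * conj (x j) = ∑ r, ∑ j, g j r * x j * conj (x r) :=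
    Finset.sum_comm
  rw [h0]
  set G : Fin n → Fin n → ℂ := fun r j => g j r * x j * conj (x r) with hG
  have h1 (r j h k : Fin n) : K / 2 * (g j r * g k h + g k r * g j h) * x j * x k * conj (x r)
      * conj (x h) = K / 2 * (G r j * G h k) + K / 2 * (G r k * G h j) := by
    simp only [hG]
    ring
  have h2 : ∑ r, ∑ j, ∑ h, ∑ k, G r j * G h k = (∑ r, ∑ j, G r j) * ∑ r, ∑ j, G r j := by
    simp only [← Finset.mul_sum, ← Finset.sum_mul]
  have h3 : ∑ r, ∑ j, ∑ h, ∑ k, G r k * G h j = ∑ r, ∑ j, ∑ h, ∑ k, G r j * G h k :=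
    Finset.sum_congr rfl fun r _ => Finset.sum_swap_outer _
  simp only [quarticForm, h1, Finset.sum_add_distrib]
  have h4 (f : Fin n → Fin n → Fin n → Fin n → ℂ) : ∑ r, ∑ j, ∑ h, ∑ k, K / 2 * f r j h k
      = K / 2 * ∑ r, ∑ j, ∑ h, ∑ k, f r j h k := by
    simp only [Finset.mul_sum]
  rw [h4, h4, h3, h2]
  ring

/-! ### Chern connection, curvature and Kähler symmetries -/

namespace IsPurelyHermitianOn

variable {F : (Fin n → ℂ) × (Fin n → ℂ) → ℝ} {U : Set (Fin n → ℂ)}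
  {p : (Fin n → ℂ) × (Fin n → ℂ)}

theorem fiberConst_metricInv (hF : IsPurelyHermitianOn F U) (i j : Fin n) :
    FiberConst U (metricInv F i j) := by
  intro z hz η η' hη hη'
  have : metricMatrix F (z, η) = metricMatrix F (z, η') := by
    ext i j
    exact hF.fiberConst i j z hz η η' hη hη'
  rw [metricInv, this, metricInv]

theorem differentiableAt_metric (hF : IsPurelyHermitianOn F U)
    (hp : p ∈ U ×ˢ ({0}ᶜ : Set (Fin n → ℂ))) (i j : Fin n) :
    DifferentiableAt ℝ (metric F i j) p :=
  ((hF.contDiffOn_metric i j).contDiffAt (mem_nhds_slit hF.isOpen hp)).differentiableAt (by simp)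

theorem contDiffAt_dz_metric (hF : IsPurelyHermitianOn F U)
    (hp : p ∈ U ×ˢ ({0}ᶜ : Set (Fin n → ℂ))) (i j k : Fin n) :
    ContDiffAt ℝ ∞ (dz k (metric F i j)) p :=
  ((hF.contDiffOn_metric i j).wirtinger hF.isOpen_slit _).contDiffAt (mem_nhds_slit hF.isOpen hp)

theorem hcoef_eq (hF : IsPurelyHermitianOn F U)
    (hp : p ∈ U ×ˢ ({0}ᶜ : Set (Fin n → ℂ))) (i j k : Fin n) :
    hcoef F i j k p = ∑ l, metricInv F l i p * dz k (metric F j l) p := by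
  simp only [hcoef, (hF.fiberConst j _).hder_eq F k hp]

theorem fiberConst_hcoef (hF : IsPurelyHermitianOn F U) (i j k : Fin n) :
    FiberConst U (hcoef F i j k) := by
  intro z hz η η' hη hη'
  rw [hF.hcoef_eq (p := (z, η)) ⟨hz, hη⟩, hF.hcoef_eq (p := (z, η')) ⟨hz, hη'⟩]
  refine Finset.sum_congr rfl fun l _ => ?_
  rw [hF.fiberConst_metricInv l i z hz η η' hη hη']
  congr 1
  exact (hF.fiberConst j l).wirtinger hF.isOpen _ z hz η η' hη hη'

theorem differentiableAt_hcoef (hF : IsPurelyHermitianOn F U)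
    (hp : p ∈ U ×ˢ ({0}ᶜ : Set (Fin n → ℂ))) (i j k : Fin n) :
    DifferentiableAt ℝ (hcoef F i j k) p := by
  have h : hcoef F i j k =ᶠ[𝓝 p] fun q => ∑ l, metricInv F l i q * dz k (metric F j l) q := by
    filter_upwards [mem_nhds_slit hF.isOpen hp] with q hq using hF.hcoef_eq hq i j k
  refine DifferentiableAt.congr_of_eventuallyEq (DifferentiableAt.fun_sum fun l _ => ?_) h
  exact ((hF.contDiffAt_metricInv hp l i).differentiableAt (by simp)).fun_mul
    ((hF.contDiffAt_dz_metric hp j l k).differentiableAt (by simp))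

theorem sum_metric_mul_hcoef (hF : IsPurelyHermitianOn F U)
    (hp : p ∈ U ×ˢ ({0}ᶜ : Set (Fin n → ℂ))) (j k r : Fin n) :
    ∑ i, metric F i r p * hcoef F i j k p = dz k (metric F j r) p := by
  simp only [hF.hcoef_eq hp, Finset.mul_sum]
  rw [Finset.sum_comm]
  have (l : Fin n) : ∑ i, metric F i r p * (metricInv F l i p * dz k (metric F j l) p)
      = (if l = r then 1 else 0) * dz k (metric F j l) p := by
    rw [← hF.sum_metricInv_mul_metric hp, Finset.sum_mul]
    exact Finset.sum_congr rfl fun i _ => by ring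
  simp [this]

/-- The Kähler condition symmetrizes the lower indices of the Chern connection. -/
theorem hcoef_symm (hF : IsPurelyHermitianOn F U) (hK : IsKahlerOn F U)
    (hp : p ∈ U ×ˢ ({0}ᶜ : Set (Fin n → ℂ))) (i j k : Fin n) :
    hcoef F i j k p = hcoef F i k j p := by
  -- The Kähler condition at $\eta=e_j$ isolates $T^i_{jk}$, and fibre constancy carries the result
  -- to the given $\eta$.
  have hs : (Pi.single j 1 : Fin n → ℂ) ≠ 0 := by simp
  have h := hK (p.1, Pi.single j 1) ⟨hp.1, hs⟩ i k
  simp only [torsion, Pi.single_apply, mul_ite, mul_one, mul_zero, Finset.sum_ite_eq',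
    Finset.mem_univ, if_true] at h
  rw [hF.fiberConst_hcoef i j k p.1 hp.1 _ p.2 hs hp.2,
    hF.fiberConst_hcoef i k j p.1 hp.1 _ p.2 hs hp.2] at h
  exact sub_eq_zero.1 h

theorem dz_metric_symm (hF : IsPurelyHermitianOn F U) (hK : IsKahlerOn F U)
    (hp : p ∈ U ×ˢ ({0}ᶜ : Set (Fin n → ℂ))) (j k r : Fin n) :
    dz k (metric F j r) p = dz j (metric F k r) p := by
  rw [← hF.sum_metric_mul_hcoef hp, ← hF.sum_metric_mul_hcoef hp]
  exact Finset.sum_congr rfl fun i _ => by rw [hF.hcoef_symm hK hp]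

theorem dzBar_metric (hF : IsPurelyHermitianOn F U)
    (hp : p ∈ U ×ˢ ({0}ᶜ : Set (Fin n → ℂ))) (i j h : Fin n) :
    dzBar h (metric F i j) p = conj (dz h (metric F j i) p) := by
  rw [dzBar, wirtingerBar_eq_conj, dz]
  congr 1
  refine wirtinger_congr ?_ _
  filter_upwards [mem_nhds_slit hF.isOpen hp] with q hq using hF.conj_metric hq i j

theorem dzBar_metric_symm (hF : IsPurelyHermitianOn F U) (hK : IsKahlerOn F U)
    (hp : p ∈ U ×ˢ ({0}ᶜ : Set (Fin n → ℂ))) (j h r : Fin n) :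
    dzBar h (metric F j r) p = dzBar r (metric F j h) p := by
  rw [hF.dzBar_metric hp, hF.dzBar_metric hp, hF.dz_metric_symm hK hp]

/-- The Chern curvature of a Hermitian metric,
`R_{r̄ j h̄ k} = -∂_{h̄} ∂_k g_{j r̄} + ∂_{h̄} g_{i r̄} L^i_{jk}`. -/
theorem riemann_eq (hF : IsPurelyHermitianOn F U)
    (hp : p ∈ U ×ˢ ({0}ᶜ : Set (Fin n → ℂ))) (r j h k : Fin n) :
    riemann F r j h k p = -dzBar h (dz k (metric F j r)) p
      + ∑ i, dzBar h (metric F i r) p * hcoef F i j k p := by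
  have hc (i : Fin n) : curvCoef F i j h k p = -dzBar h (hcoef F i j k) p := by
    have hv (l : Fin n) : vcoef F i j l p = 0 := by
      simp [vcoef, (hF.fiberConst j _).dη_eq_zero hp]
    simp [curvCoef, hv, (hF.fiberConst_hcoef i j k).hderBar_eq F h hp]
  -- Differentiating $g_{i\bar r}L^i_{jk}=\partial_kg_{j\bar r}$ avoids differentiating the inverse
  -- matrix.
  have he : dz k (metric F j r) =ᶠ[𝓝 p] fun q => ∑ i, metric F i r q * hcoef F i j k q := by
    filter_upwards [mem_nhds_slit hF.isOpen hp] with q hq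
      using (hF.sum_metric_mul_hcoef hq j k r).symm
  have hd : dzBar h (dz k (metric F j r)) p = ∑ i, (dzBar h (metric F i r) p * hcoef F i j k p
      + metric F i r p * dzBar h (hcoef F i j k) p) := by
    rw [dzBar, wirtingerBar_congr he, wirtingerBar_sum fun i _ =>
      (hF.differentiableAt_metric hp i r).fun_mul (hF.differentiableAt_hcoef hp i j k)]
    exact Finset.sum_congr rfl fun i _ =>
      wirtingerBar_mul (hF.differentiableAt_metric hp i r) (hF.differentiableAt_hcoef hp i j k) _
  rw [hd, riemann, Finset.sum_add_distrib]
  simp only [hc, mul_neg, Finset.sum_neg_distrib]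
  ring

theorem fiberConst_riemann (hF : IsPurelyHermitianOn F U) (r j h k : Fin n) :
    FiberConst U (riemann F r j h k) := by
  intro z hz η η' hη hη'
  rw [hF.riemann_eq (p := (z, η)) ⟨hz, hη⟩, hF.riemann_eq (p := (z, η')) ⟨hz, hη'⟩]
  congr 1
  · congr 1
    exact ((hF.fiberConst j r).wirtinger hF.isOpen _).wirtingerBar hF.isOpen _ z hz η η' hη hη'
  · refine Finset.sum_congr rfl fun i _ => ?_
    rw [hF.fiberConst_hcoef i j k z hz η η' hη hη']
    congr 1
    exact (hF.fiberConst i r).wirtingerBar hF.isOpen _ z hz η η' hη hη'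

theorem riemann_symm_holomorphic (hF : IsPurelyHermitianOn F U) (hK : IsKahlerOn F U)
    (hp : p ∈ U ×ˢ ({0}ᶜ : Set (Fin n → ℂ))) (r j h k : Fin n) :
    riemann F r j h k p = riemann F r k h j p := by
  rw [hF.riemann_eq hp, hF.riemann_eq hp]
  congr 1
  · congr 1
    refine wirtingerBar_congr ?_ _
    filter_upwards [mem_nhds_slit hF.isOpen hp] with q hq using hF.dz_metric_symm hK hq j k r
  · exact Finset.sum_congr rfl fun i _ => by rw [hF.hcoef_symm hK hp]

/-- The conjugate Kähler identity $\partial_{\bar h}g_{j\bar r}=\partial_{\bar r}g_{j\bar h}$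
applies to the second-order term once the derivatives are commuted. -/
theorem riemann_symm_antiholomorphic (hF : IsPurelyHermitianOn F U) (hK : IsKahlerOn F U)
    (hp : p ∈ U ×ˢ ({0}ᶜ : Set (Fin n → ℂ))) (r j h k : Fin n) :
    riemann F r j h k p = riemann F h j r k p := by
  rw [hF.riemann_eq hp, hF.riemann_eq hp]
  have hs (j r : Fin n) := (hF.contDiffOn_metric j r).contDiffAt (mem_nhds_slit hF.isOpen hp)
  congr 1
  · congr 1
    refine (wirtingerBar_wirtinger_comm (hs j r) _ _).trans
      (Eq.trans (wirtinger_congr ?_ _) (wirtingerBar_wirtinger_comm (hs j h) _ _).symm)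
    filter_upwards [mem_nhds_slit hF.isOpen hp] with q hq using hF.dzBar_metric_symm hK hq j h r
  · exact Finset.sum_congr rfl fun i _ => by rw [hF.dzBar_metric_symm hK hp]

/-! ### The invariant `𝐊` -/

/-- `N^l_h` and the Hermitian metric: `conj N^l_h = ∂_{h̄} g_{m s̄} g^{l̄ m} η̄^s`. -/
theorem conj_nonlin (hF : IsPurelyHermitianOn F U)
    (hp : p ∈ U ×ˢ ({0}ᶜ : Set (Fin n → ℂ))) (l h : Fin n) :
    conj (nonlin F l h p) =
      ∑ m, ∑ s, metricInv F l m p * dzBar h (metric F m s) p * conj (p.2 s) := by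
  simp only [nonlin, map_sum, map_mul, hF.conj_metricInv hp, hF.dzBar_metric hp]

/-- The derivative of $g$ cancels the term $-g_{i\bar l}\overline{N^l_h}$ coming from $\bar\eta^l$.
-/
theorem hderBar_metric_conj (hF : IsPurelyHermitianOn F U)
    (hp : p ∈ U ×ˢ ({0}ᶜ : Set (Fin n → ℂ))) (i h : Fin n) :
    hderBar F h (fun q => ∑ j, metric F i j q * conj (q.2 j)) p = 0 := by
  have hd (j : Fin n) := (hF.differentiableAt_metric hp i j)
  have hc (j : Fin n) := differentiable_conj_fiberCoord j p
  rw [hderBar_sum F h fun j _ => (hd j).fun_mul (hc j)]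
  simp only [hderBar_mul F h (hd _) (hc _), hderBar_conj_fiberCoord,
    (hF.fiberConst i _).hderBar_eq F h hp, hF.conj_nonlin hp, Finset.sum_add_distrib, mul_neg,
    Finset.sum_neg_distrib, Finset.mul_sum]
  rw [Finset.sum_comm]
  have (m : Fin n) : ∑ l, ∑ s, metric F i l p * (metricInv F l m p * dzBar h (metric F m s) p
      * conj (p.2 s)) = (if i = m then 1 else 0) * ∑ s, dzBar h (metric F m s) p * conj (p.2 s) := by
    rw [← hF.sum_metric_mul_metricInv hp, Finset.sum_mul_sum]
    exact Finset.sum_congr rfl fun l _ => Finset.sum_congr rfl fun s _ => by ring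
  simp [this]

theorem differentiableAt_coe (hF : IsPurelyHermitianOn F U)
    (hp : p ∈ U ×ˢ ({0}ᶜ : Set (Fin n → ℂ))) :
    DifferentiableAt ℝ (fun q => (F q : ℂ)) p := by
  have h : F = fun q => √(F q ^ 2) := funext fun q => (Real.sqrt_sq (hF.nonneg q)).symm
  have hd : DifferentiableAt ℝ F p := by
    rw [h]
    exact ((hF.smooth.contDiffAt (mem_nhds_slit hF.isOpen hp)).differentiableAt (by simp)).sqrt
      (pow_ne_zero 2 (hF.pos hp).ne')
  exact Complex.ofRealCLM.differentiableAt.comp p hd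

/-- `F` is horizontally constant. -/
theorem hderBar_coe (hF : IsPurelyHermitianOn F U)
    (hp : p ∈ U ×ˢ ({0}ᶜ : Set (Fin n → ℂ))) (h : Fin n) :
    hderBar F h (fun q => (F q : ℂ)) p = 0 := by
  have hd := hF.differentiableAt_coe hp
  -- In $F^2=\eta^i(g_{i\bar j}\bar\eta^j)$ both factors are annihilated by $\delta_{\bar h}$, so
  -- $2F\,\delta_{\bar h}F=0$.
  have he : (fun q => (F q : ℂ) * (F q : ℂ)) =ᶠ[𝓝 p]
      fun q => ∑ i, q.2 i * ∑ j, metric F i j q * conj (q.2 j) := by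
    filter_upwards [mem_nhds_slit hF.isOpen hp] with q hq
    rw [← sq, hF.sq_eq_sum hq]
    simp only [Finset.mul_sum]
    exact Finset.sum_congr rfl fun i _ => Finset.sum_congr rfl fun j _ => by ring
  have hg (i : Fin n) : DifferentiableAt ℝ (fun q => ∑ j, metric F i j q * conj (q.2 j)) p :=
    DifferentiableAt.fun_sum fun j _ =>
      (hF.differentiableAt_metric hp i j).fun_mul (differentiable_conj_fiberCoord j p)
  have h1 := hderBar_congr F h he
  rw [hderBar_mul F h hd hd, hderBar_sum F h fun i _ =>
    (differentiable_fiberCoord i p).fun_mul (hg i)] at h1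
  simp only [hderBar_mul F h (differentiable_fiberCoord _ p) (hg _), hderBar_fiberCoord,
    hF.hderBar_metric_conj hp, zero_mul, mul_zero, add_zero, Finset.sum_const_zero] at h1
  have hne : (F p : ℂ) ≠ 0 := by exact_mod_cast (hF.pos hp).ne'
  have h2 : (2 * (F p : ℂ)) * hderBar F h (fun q => (F q : ℂ)) p = 0 := by
    linear_combination h1
  exact (mul_eq_zero.1 h2).resolve_left (mul_ne_zero two_ne_zero hne)

/-- Contraction with $l_i$ lowers the upper index of $L^i_{jk}$, leaving a polynomial in
$\eta,\bar\eta$. The nested products are shaped for `hderBar_mul`. -/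
theorem coefJ_mul (hF : IsPurelyHermitianOn F U) (hp : p ∈ U ×ˢ ({0}ᶜ : Set (Fin n → ℂ))) :
    coefJ F p * ((F p : ℂ) * ((F p : ℂ) * (F p : ℂ))) =
      ∑ j, ∑ k, ∑ l, (p.2 j * p.2 k) * (conj (p.2 l) * dz k (metric F j l) p) := by
  have hne : (F p : ℂ) ≠ 0 := by exact_mod_cast (hF.pos hp).ne'
  simp only [coefJ, ← hF.sum_metric_mul_hcoef hp, lDown, lUp, map_div₀, Complex.conj_ofReal,
    Finset.mul_sum, Finset.sum_mul]
  rw [Finset.sum_comm]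
  refine Finset.sum_congr rfl fun j _ => ?_
  rw [Finset.sum_comm]
  refine Finset.sum_congr rfl fun k _ => ?_
  rw [Finset.sum_comm]
  refine Finset.sum_congr rfl fun l _ => Finset.sum_congr rfl fun i _ => ?_
  field_simp

/-- Since $\delta_{\bar h}F=0$, only the polynomial $JF^3$ is differentiated. Its coefficients give
$\partial_{\bar h}\partial_kg_{j\bar l}$, and $\bar\eta^l$ gives
$-\overline{N^l_h}\,\partial_kg_{j\bar l}$, which is the quadratic term of the Chern curvature
(`h4`). -/
theorem hderBar_coefJ (hF : IsPurelyHermitianOn F U)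
    (hp : p ∈ U ×ˢ ({0}ᶜ : Set (Fin n → ℂ))) (h : Fin n) :
    hderBar F h (coefJ F) p * (F p : ℂ) ^ 3 =
      -∑ j, ∑ k, ∑ r, riemann F r j h k p * p.2 j * p.2 k * conj (p.2 r) := by
  have hne : (F p : ℂ) ≠ 0 := by exact_mod_cast (hF.pos hp).ne'
  have hd := hF.differentiableAt_coe hp
  have hη (j : Fin n) := differentiable_fiberCoord j p
  have hc (j : Fin n) := differentiable_conj_fiberCoord j p
  have hg (j l k : Fin n) : DifferentiableAt ℝ (dz k (metric F j l)) p :=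
    (hF.contDiffAt_dz_metric hp j l k).differentiableAt (by simp)
  have hηη (j k : Fin n) := (hη j).fun_mul (hη k)
  have hcg (j l k : Fin n) := (hc l).fun_mul (hg j l k)
  have hP : DifferentiableAt ℝ (fun q : (Fin n → ℂ) × (Fin n → ℂ) =>
      ∑ j, ∑ k, ∑ l, (q.2 j * q.2 k) * (conj (q.2 l) * dz k (metric F j l) q)) p :=
    DifferentiableAt.fun_sum fun j _ => DifferentiableAt.fun_sum fun k _ =>
      DifferentiableAt.fun_sum fun l _ => (hηη j k).fun_mul (hcg j l k)
  have hJ : DifferentiableAt ℝ (coefJ F) p := by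
    refine ((hP.fun_mul ((hd.fun_mul (hd.fun_mul hd)).inv (by simp [hne])))).congr_of_eventuallyEq ?_
    filter_upwards [mem_nhds_slit hF.isOpen hp] with q hq
    have hq' : (F q : ℂ) ≠ 0 := by exact_mod_cast (hF.pos hq).ne'
    exact (eq_mul_inv_iff_mul_eq₀ (by simp [hq'])).2 (hF.coefJ_mul hq)
  have he : (fun q => coefJ F q * ((F q : ℂ) * ((F q : ℂ) * (F q : ℂ)))) =ᶠ[𝓝 p] fun q =>
      ∑ j, ∑ k, ∑ l, (q.2 j * q.2 k) * (conj (q.2 l) * dz k (metric F j l) q) := by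
    filter_upwards [mem_nhds_slit hF.isOpen hp] with q hq using hF.coefJ_mul hq
  have h1 := hderBar_congr F h he
  rw [hderBar_mul F h hJ (hd.fun_mul (hd.fun_mul hd)), hderBar_mul F h hd (hd.fun_mul hd),
    hderBar_mul F h hd hd, hF.hderBar_coe hp,
    hderBar_sum F h fun j _ => DifferentiableAt.fun_sum fun k _ =>
      DifferentiableAt.fun_sum fun l _ => (hηη j k).fun_mul (hcg j l k)] at h1
  have h2 : hderBar F h (coefJ F) p * (F p : ℂ) ^ 3
      = hderBar F h (coefJ F) p * ((F p : ℂ) * ((F p : ℂ) * (F p : ℂ))) := by ring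
  rw [h2, ← Finset.sum_neg_distrib]
  simp only [zero_mul, mul_zero, add_zero] at h1
  rw [h1]
  refine Finset.sum_congr rfl fun j _ => ?_
  rw [hderBar_sum F h fun k _ =>
      DifferentiableAt.fun_sum fun l _ => (hηη j k).fun_mul (hcg j l k), ← Finset.sum_neg_distrib]
  refine Finset.sum_congr rfl fun k _ => ?_
  rw [hderBar_sum F h fun l _ => (hηη j k).fun_mul (hcg j l k)]
  have h3 (l : Fin n) : hderBar F h (fun q => (q.2 j * q.2 k)
      * (conj (q.2 l) * dz k (metric F j l) q)) p = p.2 j * p.2 k *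
      (conj (p.2 l) * dzBar h (dz k (metric F j l)) p
        - conj (nonlin F l h p) * dz k (metric F j l) p) := by
    have hfc : FiberConst U (dz k (metric F j l)) := (hF.fiberConst j l).wirtinger hF.isOpen _
    rw [hderBar_mul F h (hηη j k) (hcg j l k), hderBar_mul F h (hη j) (hη k),
      hderBar_mul F h (hc l) (hg j l k), hderBar_fiberCoord, hderBar_fiberCoord,
      hderBar_conj_fiberCoord, hfc.hderBar_eq F h hp]
    ring
  have h4 : ∑ l, conj (nonlin F l h p) * dz k (metric F j l) p
      = ∑ r, (∑ i, dzBar h (metric F i r) p * hcoef F i j k p) * conj (p.2 r) := by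
    simp only [hF.conj_nonlin hp, hF.hcoef_eq hp, Finset.sum_mul, Finset.mul_sum]
    rw [Finset.sum_swap_outer]
    refine Finset.sum_congr rfl fun r _ => Finset.sum_congr rfl fun i _ =>
      Finset.sum_congr rfl fun l _ => ?_
    ring
  simp only [h3, hF.riemann_eq hp]
  rw [← Finset.mul_sum, Finset.sum_sub_distrib, h4, ← Finset.sum_sub_distrib, Finset.mul_sum,
    ← Finset.sum_neg_distrib]
  exact Finset.sum_congr rfl fun r _ => by ring

/-- `𝐊 L² = R_{r̄ j h̄ k} η̄^r η^j η̄^h η^k`. -/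
theorem invK_mul (hF : IsPurelyHermitianOn F U) (hp : p ∈ U ×ˢ ({0}ᶜ : Set (Fin n → ℂ))) :
    invK F p * (F p : ℂ) ^ 4 = riemannForm F p p.2 p.2 p.2 p.2 := by
  have hne : (F p : ℂ) ≠ 0 := by exact_mod_cast (hF.pos hp).ne'
  have h1 : invK F p * (F p : ℂ) ^ 4
      = ∑ h, -(conj (p.2 h) * (hderBar F h (coefJ F) p * (F p : ℂ) ^ 3)) := by
    rw [invK, Finset.mul_sum, Finset.sum_mul]
    refine Finset.sum_congr rfl fun h _ => ?_
    field_simp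
  rw [h1, riemannForm]
  simp only [hF.hderBar_coefJ hp, mul_neg, neg_neg, Finset.mul_sum]
  refine Eq.trans ?_ (Finset.sum_congr rfl fun r _ => Finset.sum_comm)
  refine Eq.trans ?_ Finset.sum_comm
  refine Finset.sum_congr rfl fun h _ => ?_
  refine Eq.trans ?_ Finset.sum_comm
  refine Finset.sum_congr rfl fun j _ => Finset.sum_comm.trans ?_
  exact Finset.sum_congr rfl fun r _ => Finset.sum_congr rfl fun k _ => by ring

/-! ### Constant `𝐊` -/

/-- If `𝐊` is constant, a Kähler purely Hermitian metric has constant holomorphic sectional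
curvature. -/
theorem riemann_eq_of_invK (hF : IsPurelyHermitianOn F U) (hK : IsKahlerOn F U) {K : ℂ}
    (hc : ∀ q ∈ U ×ˢ ({0}ᶜ : Set (Fin n → ℂ)), invK F q = K)
    (hp : p ∈ U ×ˢ ({0}ᶜ : Set (Fin n → ℂ))) (r j h k : Fin n) :
    riemann F r j h k p = K / 2 * (metric F j r p * metric F k h p
      + metric F k r p * metric F j h p) := by
  refine sub_eq_zero.1 (eq_zero_of_quarticForm_diag (S := fun r j h k => riemann F r j h k p
    - K / 2 * (metric F j r p * metric F k h p + metric F k r p * metric F j h p)) ?_ ?_ ?_ r j h k)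
  · intro r j h k
    rw [hF.riemann_symm_holomorphic hK hp]
    ring
  · intro r j h k
    rw [hF.riemann_symm_antiholomorphic hK hp]
    ring
  · intro x
    by_cases hx : x = 0
    · simp [quarticForm, hx]
    -- The test vector $x$ serves as fibre coordinate: $R$ and $g$ have the same values at $(z,x)$
    -- as at $p$, so constancy of $\mathbf K$ along the fibre gives the whole diagonal.
    have hq : (p.1, x) ∈ U ×ˢ ({0}ᶜ : Set (Fin n → ℂ)) := ⟨hp.1, hx⟩
    have hR := hF.invK_mul hq
    have hg (i j : Fin n) : metric F i j (p.1, x) = metric F i j p :=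
      hF.fiberConst i j p.1 hp.1 x p.2 hx hp.2
    have hr (r j h k : Fin n) : riemann F r j h k (p.1, x) = riemann F r j h k p :=
      hF.fiberConst_riemann r j h k p.1 hp.1 x p.2 hx hp.2
    have h4 : (F (p.1, x) : ℂ) ^ 4 = (F (p.1, x) : ℂ) ^ 2 * (F (p.1, x) : ℂ) ^ 2 := by ring
    rw [hc _ hq, h4, hF.sq_eq_sum hq] at hR
    simp only [riemannForm, hr, hg] at hR
    have hS := quarticForm_metric (fun i j => metric F i j p) K x
    rw [quarticForm] at hS ⊢
    simp only [sub_mul, Finset.sum_sub_distrib]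
    rw [hS, sub_eq_zero, hR]
    refine Finset.sum_congr rfl fun r _ => Finset.sum_congr rfl fun j _ =>
      Finset.sum_congr rfl fun h _ => Finset.sum_congr rfl fun k _ => by ring

/-- The holomorphic sectional curvature in the direction of a unit vector. -/
theorem riemannForm_eq_of_invK (hF : IsPurelyHermitianOn F U) (hK : IsKahlerOn F U) {K : ℂ}
    (hc : ∀ q ∈ U ×ˢ ({0}ᶜ : Set (Fin n → ℂ)), invK F q = K)
    (hp : p ∈ U ×ˢ ({0}ᶜ : Set (Fin n → ℂ))) {W : Fin n → ℂ}
    (hW : ∑ i, ∑ j, metric F i j p * W i * conj (W j) = 1) :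
    riemannForm F p W W W W = K := by
  have hS := quarticForm_metric (fun i j => metric F i j p) K W
  simp only [hW, mul_one] at hS
  rw [← hS, riemannForm, quarticForm]
  refine Finset.sum_congr rfl fun r _ => Finset.sum_congr rfl fun j _ =>
    Finset.sum_congr rfl fun h _ => Finset.sum_congr rfl fun k _ => ?_
  rw [hF.riemann_eq_of_invK hK hc hp]
  ring

theorem sum_metric_lUp (hF : IsPurelyHermitianOn F U)
    (hp : p ∈ U ×ˢ ({0}ᶜ : Set (Fin n → ℂ))) :
    ∑ i, ∑ j, metric F i j p * lUp F p i * conj (lUp F p j) = 1 := by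
  have hne : (F p : ℂ) ≠ 0 := by exact_mod_cast (hF.pos hp).ne'
  refine mul_right_cancel₀ (pow_ne_zero 2 hne) ?_
  rw [one_mul]
  refine Eq.trans ?_ (hF.sq_eq_sum hp).symm
  simp only [Finset.sum_mul]
  refine Finset.sum_congr rfl fun i _ => Finset.sum_congr rfl fun j _ => ?_
  simp only [lUp, map_div₀, Complex.conj_ofReal]
  field_simp

/-- For a $2\times2$ matrix, inserting $(-l_2,l_1)$ into $g$ gives the adjugate form on the covector
$l_i$. Division by $\det g$ turns it into the inverse-metric norm of $l_i$, equal to that of $l^i$.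
-/
theorem sum_metric_mUp {F : (Fin 2 → ℂ) × (Fin 2 → ℂ) → ℝ} {U : Set (Fin 2 → ℂ)}
    {p : (Fin 2 → ℂ) × (Fin 2 → ℂ)} (hF : IsPurelyHermitianOn F U)
    (hp : p ∈ U ×ˢ ({0}ᶜ : Set (Fin 2 → ℂ))) :
    ∑ i, ∑ j, metric F i j p * mUp F p i * conj (mUp F p j) = 1 := by
  have hl := hF.sum_metric_lUp hp
  have hdet := (hF.posDef p hp).det_pos
  obtain ⟨hre, him⟩ := Complex.pos_iff.1 hdet
  set d := (metricMatrix F p).det with hd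
  -- The determinant is positive, hence real, so the real part in the definition of $m$ loses
  -- nothing.
  have hs : ((√d.re : ℝ) : ℂ) ^ 2 = d := by
    rw [← Complex.ofReal_pow, Real.sq_sqrt hre.le]
    exact Complex.ext rfl (by simpa using him)
  have hs0 : ((√d.re : ℝ) : ℂ) ≠ 0 := by exact_mod_cast (Real.sqrt_pos.2 hre).ne'
  have hd2 : d = metric F 0 0 p * metric F 1 1 p - metric F 0 1 p * metric F 1 0 p := by
    rw [hd, Matrix.det_fin_two]
    rfl
  simp only [Fin.sum_univ_two] at hl
  simp only [mUp, ← hd, Fin.sum_univ_two, Matrix.cons_val_zero, Matrix.cons_val_one, map_div₀,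
    map_neg, Complex.conj_ofReal, lDown, map_add, map_mul, Complex.conj_conj, hF.conj_metric hp]
  field_simp
  rw [hs, hd2]
  linear_combination (metric F 0 0 p * metric F 1 1 p - metric F 0 1 p * metric F 1 0 p) * hl

end IsPurelyHermitianOn
end FinslerCoord

/-! ### Passage from the manifold to a chart -/

section Manifold

variable {n : ℕ} {M : Type*} [TopologicalSpace M] [ChartedSpace (Fin n → ℂ) M]

theorem IsComplexFinsler.isPurelyHermitianOn [IsManifold 𝓘(ℂ, Fin n → ℂ) ω M]
    {F : TangentBundle 𝓘(ℂ, Fin n → ℂ) M → ℝ} (hF : IsComplexFinsler F)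
    (hH : IsPurelyHermitian F) {φ : OpenPartialHomeomorph M (Fin n → ℂ)}
    (hφ : φ ∈ IsManifold.maximalAtlas 𝓘(ℂ, Fin n → ℂ) ω M) :
    FinslerCoord.IsPurelyHermitianOn (inCoord F φ) φ.target where
  isOpen := φ.open_target
  smooth := hF.smooth φ hφ
  nonneg _ := hF.nonneg _
  homogeneous z _ η a :=
    (congrArg (fun v => F ⟨φ.symm z, v⟩) (map_smul (mfderiv 𝓘(ℂ, Fin n → ℂ) 𝓘(ℂ, Fin n → ℂ)
      φ.symm z) a η)).trans (hF.homogeneous _ _ a)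
  posDef p hp := hF.posDef φ hφ p.1 hp.1 p.2 hp.2
  fiberConst i j z hz η η' hη hη' := hH φ hφ z hz η η' hη hη' i j

end Manifold

end

theorem theorem4p13 {M : Type*} [TopologicalSpace M] [ChartedSpace (Fin 2 → ℂ) M]
    [IsManifold 𝓘(ℂ, Fin 2 → ℂ) ω M] (F : TangentBundle 𝓘(ℂ, Fin 2 → ℂ) M → ℝ)
    (hF : IsComplexFinsler F) (hHerm : IsPurelyHermitian F) (hKahler : IsKahlerFinsler F)
    (K : ℂ) (hK : HasConstantK F K)
    (φ : OpenPartialHomeomorph M (Fin 2 → ℂ))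
    (hφ : φ ∈ IsManifold.maximalAtlas 𝓘(ℂ, Fin 2 → ℂ) ω M)
    (z : Fin 2 → ℂ) (hz : z ∈ φ.target) (η : Fin 2 → ℂ) (hη : η ≠ 0) :
    (∀ r j h k : Fin 2,
      FinslerCoord.riemann (inCoord F φ) r j h k (z, η) =
        K / 2 *
          (FinslerCoord.metric (inCoord F φ) j r (z, η) *
              FinslerCoord.metric (inCoord F φ) k h (z, η) +
            FinslerCoord.metric (inCoord F φ) k r (z, η) *
              FinslerCoord.metric (inCoord F φ) j h (z, η))) ∧
      FinslerCoord.sectCurvLambda (inCoord F φ) (z, η) = 2 * K ∧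
      FinslerCoord.sectCurvMu (inCoord F φ) (z, η) = 2 * K := by
  have hH := hF.isPurelyHermitianOn hHerm hφ
  have hp : (z, η) ∈ φ.target ×ˢ ({0}ᶜ : Set (Fin 2 → ℂ)) := ⟨hz, hη⟩
  have hKo : FinslerCoord.IsKahlerOn (inCoord F φ) φ.target :=
    fun p hp i k => hKahler φ hφ p.1 hp.1 p.2 hp.2 i k
  have hc : ∀ q ∈ φ.target ×ˢ ({0}ᶜ : Set (Fin 2 → ℂ)), FinslerCoord.invK (inCoord F φ) q = K :=
    fun q hq => hK φ hφ q.1 hq.1 q.2 hq.2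
  refine ⟨fun r j h k => hH.riemann_eq_of_invK hKo hc hp r j h k, ?_, ?_⟩
  · rw [FinslerCoord.sectCurvLambda, hH.riemannForm_eq_of_invK hKo hc hp (hH.sum_metric_lUp hp)]
  · rw [FinslerCoord.sectCurvMu, hH.riemannForm_eq_of_invK hKo hc hp (hH.sum_metric_mUp hp)]
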